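/- All graphs are finite and simple. For a graph $G$ let $\kappa(G)$ be the number of cliques of $G$ with at least $2$ vertices. Let $m,r\ge 1$ be integers, write $m=a\binom{r+1}{2}+b$ with integers $a\ge 0$ and $0\le b<\binom{r+1}{2}$, and put $g(m,r)=\kappa\bigl(aK_{r+1}\cup\mathcal C(b)\bigr)$, where $aK_{r+1}$ denotes $a$ disjoint copies of the complete graph $K_{r+1}$, the union is disjoint, and $\mathcal C(b)$ is the colex graph: the graph on $\mathbb N=\{0,1,2,\dots\}$ whose edges are the first $b$ pairs in the colexicographic order on pairs. Let $G$ be a graph with maximum degree at most $r$. For a set $T$ of vertices let $N(T)$ be the set of common neighbours of all vertices of $T$. A non-empty clique $T$ of $G$ is tight if $|N(T)|=r+1-|T|$; a cluster is an inclusion-maximal tight clique. For a cluster $T$ put $S=N(T)$, let $e(R_T)$ be the number of pairs of distinct vertices of $S$ that are not adjacent in $G$, and let the folding $G_T$ be the graph obtained from $G$ by adding all missing edges inside $S$ and deleting all edges between $S$ and $V(G)\setminus(T\cup S)$. The cluster $T$ is unfoldable if $\kappa(G)\ge\kappa(G_T)$. Theorem. Let $G$ be a connected graph with $m$ edges and maximum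 degree at most $r$, where $m\ge\binom{r+1}{2}$ and $G$ is not a complete graph. Suppose that every cluster $T$ of $G$ either (1) is unfoldable, or (2) satisfies $e(R_T)\ge r-2$ and $|T|\le r/2$. Then $G$ is not extremal, i.e. $\kappa(G)$ is not the maximum of $\kappa$ over all graphs with $m$ edges and maximum degree at most $r$; moreover $\kappa(G)<g(m,r)$. -/

import Mathlib

/-- The number `κ(G)` of cliques of `G` with at least two vertices. -/
noncomputable def numCliques {V : Type*} (G : SimpleGraph V) : ℕ :=
  {K : Finset V | G.IsClique (K : Set V) ∧ 2 ≤ K.card}.ncard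

open Classical in
/-- The class `𝒢(m, r)` of finite graphs with `m` edges and maximum degree at most `r`. -/
def HasEdgesMaxDegree {V : Type*} [Fintype V] (G : SimpleGraph V) (m r : ℕ) : Prop :=
  G.edgeFinset.card = m ∧ G.maxDegree ≤ r

/-- `G` is extremal for `(m, r)`: it is in `𝒢(m, r)` and has the most cliques among all finite
graphs in `𝒢(m, r)` (on any number of vertices). -/
def IsExtremal {V : Type*} [Fintype V] (G : SimpleGraph V) (m r : ℕ) : Prop :=
  HasEdgesMaxDegree G m r ∧
    ∀ (n : ℕ) (H : SimpleGraph (Fin n)), HasEdgesMaxDegree H m r → numCliques H ≤ numCliques G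

/-- The colex graph `𝒞(b)` on `ℕ`, whose edges are the first `b` pairs in colexicographic order:
the pair `{i, j}` with `i < j` is preceded by exactly `j.choose 2 + i` pairs. -/
def colexGraph (b : ℕ) : SimpleGraph ℕ where
  Adj x y := x ≠ y ∧ (max x y).choose 2 + min x y < b
  symm := ⟨fun x y h => ⟨h.1.symm, by rw [max_comm, min_comm]; exact h.2⟩⟩
  loopless := ⟨fun _ h => h.1 rfl⟩

/-- The disjoint union of `a` copies of the complete graph on `n` vertices. -/
def copiesComplete (a n : ℕ) : SimpleGraph (Fin a × Fin n) where
  Adj p q := p.1 = q.1 ∧ p.2 ≠ q.2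
  symm := ⟨fun _ _ h => ⟨h.1.symm, h.2.symm⟩⟩
  loopless := ⟨fun _ h => h.2 rfl⟩

/-- `g(m, r) = κ(a K_{r+1} ∪ 𝒞(b))` where `m = a * (r+1).choose 2 + b`
and `0 ≤ b < (r+1).choose 2`. -/
noncomputable def gBound (m r : ℕ) : ℕ :=
  numCliques (SimpleGraph.sum (copiesComplete (m / (r + 1).choose 2) (r + 1))
    (colexGraph (m % (r + 1).choose 2)))

namespace SimpleGraph

variable {V : Type*}

/-- The set `N(T)` of common neighbours of all vertices of `T`. -/
def commonNbrs (G : SimpleGraph V) (T : Finset V) : Set V :=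
  {v | ∀ u ∈ T, G.Adj u v}

/-- A (non-empty) clique `T` is tight if `|N(T)| = r + 1 - |T|`. -/
def IsTightClique (G : SimpleGraph V) (r : ℕ) (T : Finset V) : Prop :=
  T.Nonempty ∧ G.IsClique (T : Set V) ∧ (G.commonNbrs T).ncard + T.card = r + 1

/-- A cluster is an inclusion-maximal tight clique. -/
def IsCluster (G : SimpleGraph V) (r : ℕ) (T : Finset V) : Prop :=
  Maximal (G.IsTightClique r) T

/-- The graph `B_T` of edges of `G` between `S = N(T)` and `V ∖ (T ∪ S)`. -/
def blueGraph (G : SimpleGraph V) (T : Finset V) : SimpleGraph V where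
  Adj u v := G.Adj u v ∧
    ((u ∈ G.commonNbrs T ∧ v ∉ (T : Set V) ∪ G.commonNbrs T) ∨
      (v ∈ G.commonNbrs T ∧ u ∉ (T : Set V) ∪ G.commonNbrs T))
  symm := ⟨fun _ _ h => ⟨h.1.symm, h.2.symm⟩⟩
  loopless := ⟨fun _ h => h.1.ne rfl⟩

/-- The graph `R_T` of non-edges of `G` inside `S = N(T)`. -/
def redGraph (G : SimpleGraph V) (T : Finset V) : SimpleGraph (G.commonNbrs T) :=
  (G.induce (G.commonNbrs T))ᶜ

/-- The complete graph on the vertex subset `S`, as a graph on `V`. -/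
def completeOn (S : Set V) : SimpleGraph V where
  Adj u v := u ∈ S ∧ v ∈ S ∧ u ≠ v
  symm := ⟨fun _ _ h => ⟨h.2.1, h.1, h.2.2.symm⟩⟩
  loopless := ⟨fun _ h => h.2.2 rfl⟩

/-- The folding `G_T` of `G` at `T`: all edges inside `S = N(T)` are added and all edges
between `S` and `V ∖ (T ∪ S)` are deleted. -/
def folding (G : SimpleGraph V) (T : Finset V) : SimpleGraph V :=
  (G ⊔ completeOn (G.commonNbrs T)) \ G.blueGraph T

/-- `T` is unfoldable if folding at `T` does not increase the number of cliques. -/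
def IsUnfoldable (G : SimpleGraph V) (T : Finset V) : Prop :=
  numCliques (G.folding T) ≤ numCliques G

end SimpleGraph

/-!
The total number of cliques of `G` is bounded linearly in the number of edges, with a constant so
much smaller than the clique density of `K_{r+1}` that even a single copy of `K_{r+1}` together
with the colex graph on the remaining edges does better.

Let `F d = 2 ^ (d + 1) - d - 2` be the number of cliques of `K_{d+1}` with at least two vertices.
Distribute each clique `K` equally among its vertices. The weight received by `v` is
`∫₀¹ I(N(v), x) dx - 1`, where `I(U, x)` is the sum of `x ^ |A|` over the cliques `A ⊆ U`. The claim
(`SimpleGraph.cliqueWeight_le`) is that it is at most `deg v * F (r - 1) / ((r - 1) r)`, which is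
what each vertex of `K_r` gets per incident edge, so that `κ(G) ≤ 2 m F (r - 1) / ((r - 1) r)`. This
is below `g(m, r)` by `linear_bound_lt`.

If `deg v < r` the claim holds because the clique density of complete graphs increases with their
size. If `deg v = r`, then `v` lies in a cluster `T`, and its closed neighbourhood is `T ∪ S` with
`S = N(T)`. Since `T` is maximal, no vertex of `S` is adjacent to all the others, and this makes
`I(S, x)` at most `2 (1 + x) ^ (|S| - 2)`, apart from two exceptional shapes of the non-edges in `S`
(`SimpleGraph.cliquePoly_le_of_forall_exists_not_adj`). The vertices of `T` other than `v`
contribute a factor `(1 + x) ^ (|T| - 1)`. With the generic bound the claim follows from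
`∫₀¹ 2 (1 + x) ^ (r - 2) dx = F (r - 1) / (r - 1) + 1`; the exceptional shapes need `2 |T| ≤ r`
in addition (`SimpleGraph.cliqueWeight_le_of_cluster`).

The inequality `2 |T| ≤ r` is part of the second alternative for clusters, and it also holds for
unfoldable clusters: comparing the cliques created and destroyed by folding at `T` gives
`2 ^ |T| ≤ |S| = r + 1 - |T|` (`SimpleGraph.IsUnfoldable.two_pow_card_le`).
-/

open Finset

/-! ### Clique polynomials -/

namespace SimpleGraph

section CliquePolynomial

open scoped Classical

variable {V : Type*}

/-- The clique polynomial of the subgraph of `G` induced on the finite set `U`, evaluated at `x`;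
the empty clique is counted. -/
noncomputable def cliquePoly (G : SimpleGraph V) (U : Finset V) (x : ℝ) : ℝ :=
  ∑ A ∈ U.powerset.filter (fun A : Finset V => G.IsClique (A : Set V)), x ^ #A

lemma cliquePoly_empty (G : SimpleGraph V) (x : ℝ) : G.cliquePoly ∅ x = 1 := by
  simp [cliquePoly, Finset.filter_singleton]

lemma cliquePoly_nonneg (G : SimpleGraph V) (U : Finset V) {x : ℝ} (hx : 0 ≤ x) :
    0 ≤ G.cliquePoly U x :=
  Finset.sum_nonneg fun _ _ => pow_nonneg hx _

lemma cliquePoly_mono (G : SimpleGraph V) {U W : Finset V} (h : U ⊆ W) {x : ℝ} (hx : 0 ≤ x) :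
    G.cliquePoly U x ≤ G.cliquePoly W x :=
  Finset.sum_le_sum_of_subset_of_nonneg
    (Finset.filter_subset_filter _ (Finset.powerset_mono.2 h)) fun _ _ _ => pow_nonneg hx _

lemma cliquePoly_insert (G : SimpleGraph V) {y : V} {U : Finset V} (hy : y ∉ U) (x : ℝ) :
    G.cliquePoly (insert y U) x =
      G.cliquePoly U x + x * G.cliquePoly (U.filter (G.Adj y)) x := by
  unfold cliquePoly
  rw [Finset.powerset_insert, Finset.filter_union, Finset.sum_union]
  · congr 1
    rw [Finset.mul_sum]
    symm
    refine Finset.sum_bij (fun A _ => insert y A) ?_ ?_ ?_ ?_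
    · intro A hA
      simp only [Finset.mem_filter, Finset.mem_powerset, Finset.mem_image] at hA ⊢
      refine ⟨⟨A, fun a ha => (Finset.mem_filter.1 (hA.1 ha)).1, rfl⟩, ?_⟩
      rw [Finset.coe_insert, isClique_insert]
      exact ⟨hA.2, fun b hb _ => (Finset.mem_filter.1 (hA.1 hb)).2⟩
    · intro A hA B hB h
      simp only [Finset.mem_filter, Finset.mem_powerset] at hA hB
      have hyA : y ∉ A := fun h => hy (Finset.mem_filter.1 (hA.1 h)).1
      have hyB : y ∉ B := fun h => hy (Finset.mem_filter.1 (hB.1 h)).1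
      rw [← Finset.erase_insert hyA, h, Finset.erase_insert hyB]
    · intro B hB
      simp only [Finset.mem_filter, Finset.mem_powerset, Finset.mem_image] at hB
      obtain ⟨⟨A, hA, rfl⟩, hc⟩ := hB
      rw [Finset.coe_insert, isClique_insert] at hc
      refine ⟨A, ?_, rfl⟩
      simp only [Finset.mem_filter, Finset.mem_powerset]
      exact ⟨fun a ha => Finset.mem_filter.2
        ⟨hA ha, hc.2 a ha fun h => hy (h ▸ hA ha)⟩, hc.1⟩
    · intro A hA
      simp only [Finset.mem_filter, Finset.mem_powerset] at hA
      have hyA : y ∉ A := fun h => hy (Finset.mem_filter.1 (hA.1 h)).1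
      rw [Finset.card_insert_of_notMem hyA, pow_succ']
  · rw [Finset.disjoint_left]
    intro A hA hA'
    simp only [Finset.mem_filter, Finset.mem_powerset, Finset.mem_image] at hA hA'
    obtain ⟨⟨B, _, rfl⟩, _⟩ := hA'
    exact hy (hA.1 (Finset.mem_insert_self _ _))

lemma cliquePoly_insert_le (G : SimpleGraph V) (y : V) (U : Finset V) {x : ℝ} (hx : 0 ≤ x) :
    G.cliquePoly (insert y U) x ≤ (1 + x) * G.cliquePoly U x := by
  by_cases hy : y ∈ U
  · rw [Finset.insert_eq_of_mem hy]
    nlinarith [mul_nonneg hx (G.cliquePoly_nonneg U hx)]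
  · rw [G.cliquePoly_insert hy]
    nlinarith [mul_le_mul_of_nonneg_left
      (G.cliquePoly_mono (Finset.filter_subset (G.Adj y) U) hx) hx]

lemma cliquePoly_union_le (G : SimpleGraph V) (W U : Finset V) {x : ℝ} (hx : 0 ≤ x) :
    G.cliquePoly (W ∪ U) x ≤ (1 + x) ^ #W * G.cliquePoly U x := by
  induction W using Finset.induction_on with
  | empty => simp
  | insert y W hy ih =>
    rw [Finset.insert_union, Finset.card_insert_of_notMem hy, pow_succ', mul_assoc]
    exact (G.cliquePoly_insert_le y _ hx).trans (mul_le_mul_of_nonneg_left ih (by linarith))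

lemma cliquePoly_le (G : SimpleGraph V) (U : Finset V) {x : ℝ} (hx : 0 ≤ x) :
    G.cliquePoly U x ≤ (1 + x) ^ #U := by
  simpa [cliquePoly_empty] using G.cliquePoly_union_le U ∅ hx

/-- A non-adjacent pair contributes a factor `1 + 2 x` instead of `(1 + x) ^ 2`. -/
lemma cliquePoly_insert_insert_le (G : SimpleGraph V) {y z : V} {U : Finset V}
    (hy : y ∉ insert z U) (hyz : ¬ G.Adj y z) {x : ℝ} (hx : 0 ≤ x) :
    G.cliquePoly (insert y (insert z U)) x ≤ (1 + 2 * x) * G.cliquePoly U x := by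
  rw [G.cliquePoly_insert hy, Finset.filter_insert, if_neg hyz]
  nlinarith [mul_le_mul_of_nonneg_left
    (G.cliquePoly_mono (Finset.filter_subset (G.Adj y) U) hx) hx, G.cliquePoly_insert_le z U hx]

/-- The form of `cliquePoly_insert_insert_le` that removes a non-adjacent pair from a set. -/
lemma cliquePoly_le_erase_erase (G : SimpleGraph V) {y z : V} {S : Finset V} (hy : y ∈ S)
    (hz : z ∈ S) (hne : y ≠ z) (hyz : ¬ G.Adj y z) {x : ℝ} (hx : 0 ≤ x) :
    G.cliquePoly S x ≤ (1 + 2 * x) * G.cliquePoly ((S.erase y).erase z) x := by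
  have h1 : insert z ((S.erase y).erase z) = S.erase y :=
    Finset.insert_erase (Finset.mem_erase.2 ⟨hne.symm, hz⟩)
  have h2 : insert y (insert z ((S.erase y).erase z)) = S := by
    rw [h1, Finset.insert_erase hy]
  have := G.cliquePoly_insert_insert_le (U := (S.erase y).erase z) (y := y) (z := z)
    (by rw [h1]; simp) hyz hx
  rwa [h2] at this

/-- If no vertex of `S` is adjacent to all others, then the clique polynomial of `S` is at most
`2 (1 + x) ^ (|S| - 2)`, except when the complement graph on `S` is a spanning star with possibly
further edges, or a perfect matching on four vertices. -/
lemma cliquePoly_le_of_forall_exists_not_adj (G : SimpleGraph V) {S : Finset V}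
    (hS : S.Nonempty) (h : ∀ y ∈ S, ∃ z ∈ S, z ≠ y ∧ ¬ G.Adj y z) :
    (2 ≤ #S ∧ ∀ x : ℝ, 0 ≤ x → x ≤ 1 → G.cliquePoly S x ≤ 2 * (1 + x) ^ (#S - 2)) ∨
    (2 ≤ #S ∧ ∀ x : ℝ, 0 ≤ x → G.cliquePoly S x ≤ (1 + x) ^ (#S - 1) + x) ∨
    (#S = 4 ∧ ∀ x : ℝ, 0 ≤ x → G.cliquePoly S x ≤ (1 + 2 * x) ^ 2) := by
  have two : 2 ≤ #S := by
    obtain ⟨y, hy⟩ := hS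
    obtain ⟨z, hz, hzy, -⟩ := h y hy
    exact Finset.one_lt_card.2 ⟨z, hz, y, hy, hzy⟩
  -- A vertex `y` isolated in `G[S]`: the complement graph contains a spanning star.
  by_cases h2 : ∃ y ∈ S, ∀ z ∈ S, ¬ G.Adj y z
  · right; left
    obtain ⟨y, hy, hyS⟩ := h2
    refine ⟨two, fun x hx => ?_⟩
    have e : (S.erase y).filter (G.Adj y) = ∅ :=
      Finset.filter_eq_empty_iff.2 fun z hz => hyS z (Finset.mem_of_mem_erase hz)
    have := G.cliquePoly_insert (Finset.notMem_erase y S) x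
    rw [Finset.insert_erase hy, e, cliquePoly_empty] at this
    have h' := G.cliquePoly_le (S.erase y) hx
    rw [Finset.card_erase_of_mem hy] at h'
    linarith
  push Not at h2
  by_cases h1 : ∃ y ∈ S, ∃ a ∈ S, ∃ b ∈ S, a ≠ y ∧ b ≠ y ∧ a ≠ b ∧ ¬ G.Adj y a ∧ ¬ G.Adj y b
  · -- Cliques through `y` avoid `a` and `b`; cliques avoiding `y` do not contain a non-adjacent
    -- pair `z`, `w` of other vertices.
    left
    obtain ⟨y, hy, a, ha, b, hb, hay, hby, hab, hya, hyb⟩ := h1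
    obtain ⟨z, hz, hyz⟩ := h2 y hy
    obtain ⟨w, hw, hwz, hzw⟩ := h z hz
    have hwy : w ≠ y := by rintro rfl; exact hzw hyz.symm
    have three : 3 ≤ #S := by
      have : ({y, a, b} : Finset V) ⊆ S := by
        intro c hc; simp only [Finset.mem_insert, Finset.mem_singleton] at hc
        rcases hc with rfl | rfl | rfl <;> assumption
      have h3 := Finset.card_le_card this
      rwa [Finset.card_insert_of_notMem (by simp [hay.symm, hby.symm]), Finset.card_pair hab] at h3
    refine ⟨two, fun x hx hx1 => ?_⟩
    have e1 := G.cliquePoly_insert (Finset.notMem_erase y S) x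
    rw [Finset.insert_erase hy] at e1
    have e2 : G.cliquePoly (S.erase y) x ≤ (1 + 2 * x) * (1 + x) ^ (#S - 3) := by
      have hz' : z ∈ S.erase y := Finset.mem_erase.2 ⟨hyz.ne', hz⟩
      have hw' : w ∈ S.erase y := Finset.mem_erase.2 ⟨hwy, hw⟩
      refine (G.cliquePoly_le_erase_erase hz' hw' hwz.symm hzw hx).trans ?_
      refine mul_le_mul_of_nonneg_left ?_ (by linarith)
      refine (G.cliquePoly_le _ hx).trans_eq ?_
      rw [Finset.card_erase_of_mem (Finset.mem_erase.2 ⟨hwz, hw'⟩), Finset.card_erase_of_mem hz',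
        Finset.card_erase_of_mem hy]
      congr 1
    have e3 : G.cliquePoly ((S.erase y).filter (G.Adj y)) x ≤ (1 + x) ^ (#S - 3) := by
      refine (G.cliquePoly_mono (W := ((S.erase y).erase a).erase b) ?_ hx).trans ?_
      · intro c hc
        simp only [Finset.mem_filter, Finset.mem_erase] at hc ⊢
        refine ⟨?_, ?_, hc.1⟩
        · rintro rfl; exact hyb hc.2
        · rintro rfl; exact hya hc.2
      · refine (G.cliquePoly_le _ hx).trans_eq ?_
        rw [Finset.card_erase_of_mem (by simp [*, hab.symm]),
          Finset.card_erase_of_mem (by simp [*]), Finset.card_erase_of_mem hy]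
        congr 1
    obtain ⟨k, hk⟩ : ∃ k, #S = k + 3 := ⟨#S - 3, by omega⟩
    rw [hk] at e2 e3 ⊢
    rw [show k + 3 - 2 = k + 1 by omega, pow_succ]
    rw [show k + 3 - 3 = k by omega] at e2 e3
    have hp : 0 ≤ (1 + x) ^ k := by positivity
    nlinarith [mul_le_mul_of_nonneg_left e3 hx, mul_nonneg hp (sub_nonneg.2 hx1)]
  · push Not at h1
    -- The complement graph on `S` is a perfect matching; remove its edges one by one.
    obtain ⟨y, hy⟩ := hS
    obtain ⟨y', hy', hyne, hyy⟩ := h y hy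
    obtain ⟨z, hz, hyz⟩ := h2 y hy
    have hzy' : z ≠ y' := by rintro rfl; exact hyy hyz
    obtain ⟨z', hz', hzne, hzz⟩ := h z hz
    have hz'y : z' ≠ y := by rintro rfl; exact hzz hyz.symm
    have hz'y' : z' ≠ y' := by
      rintro rfl
      exact hzz (h1 z' hy' y hy z hz hyne.symm hzne.symm hyz.ne
        (fun h => hyy h.symm)).symm
    have mz : z ∈ (S.erase y).erase y' := by simp [*, hyz.ne']
    have mz' : z' ∈ (S.erase y).erase y' := by simp [*]
    have c4 : #((((S.erase y).erase y').erase z).erase z') + 4 = #S := by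
      have a1 := Finset.card_erase_add_one (s := ((S.erase y).erase y').erase z) (a := z')
        (by simp [*])
      have a2 := Finset.card_erase_add_one mz
      have a3 := Finset.card_erase_add_one (s := S.erase y) (a := y') (by simp [*])
      have a4 := Finset.card_erase_add_one hy
      omega
    have b4 : ∀ x : ℝ, 0 ≤ x → G.cliquePoly S x ≤
        (1 + 2 * x) ^ 2 * G.cliquePoly ((((S.erase y).erase y').erase z).erase z') x := by
      intro x hx
      refine (G.cliquePoly_le_erase_erase hy hy' hyne.symm hyy hx).trans ?_
      rw [pow_two, mul_assoc]
      exact mul_le_mul_of_nonneg_left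
        (G.cliquePoly_le_erase_erase mz mz' hzne.symm hzz hx) (by linarith)
    rcases ((((S.erase y).erase y').erase z).erase z').eq_empty_or_nonempty with he | ⟨w, hw⟩
    · right; right
      rw [he] at c4 b4
      refine ⟨by simpa using c4.symm, fun x hx => ?_⟩
      simpa [cliquePoly_empty] using b4 x hx
    · left
      have hw0 := hw
      simp only [Finset.mem_erase] at hw
      obtain ⟨hw1, hw2, hw3, hw4, hwS⟩ := hw
      obtain ⟨w', hw'S, hwne, hww⟩ := h w hwS
      have key : ∀ p ∈ S, ∀ q ∈ S, q ≠ p → ¬ G.Adj p q → w ≠ p → w ≠ q → w' ≠ q := by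
        rintro p hp q hq hqp hpq hwp hwq rfl
        exact hww (h1 w' hw'S p hp w hwS hqp.symm hwne.symm (Ne.symm hwp)
          (fun h => hpq h.symm)).symm
      have mw' : w' ∈ (((S.erase y).erase y').erase z).erase z' := by
        simp only [Finset.mem_erase]
        refine ⟨key z hz z' hz' hzne hzz hw2 hw1,
          key z' hz' z hz hzne.symm (fun h => hzz h.symm) hw1 hw2,
          key y hy y' hy' hyne hyy hw4 hw3,
          key y' hy' y hy hyne.symm (fun h => hyy h.symm) hw3 hw4, hw'S⟩
      refine ⟨two, fun x hx hx1 => ?_⟩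
      have e1 := G.cliquePoly_le_erase_erase hw0 mw' hwne.symm hww hx
      have e2 := G.cliquePoly_le
        ((((((S.erase y).erase y').erase z).erase z').erase w).erase w') hx
      have a1 := Finset.card_erase_add_one (a := w')
        (s := ((((S.erase y).erase y').erase z).erase z').erase w)
        (Finset.mem_erase.2 ⟨hwne, mw'⟩)
      have a2 := Finset.card_erase_add_one hw0
      set Q := #((((((S.erase y).erase y').erase z).erase z').erase w).erase w')
      have hQ : #S - 2 = Q + 4 := by omega
      rw [hQ, pow_add]
      have hp : 0 ≤ (1 + x) ^ Q := by positivity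
      calc G.cliquePoly S x ≤ (1 + 2 * x) ^ 2 * ((1 + 2 * x) * (1 + x) ^ Q) :=
            (b4 x hx).trans (mul_le_mul_of_nonneg_left
              (e1.trans (mul_le_mul_of_nonneg_left e2 (by linarith))) (by positivity))
        _ = (1 + x) ^ Q * (1 + 2 * x) ^ 3 := by ring
        _ ≤ (1 + x) ^ Q * (2 * (1 + x) ^ 4) := by
            refine mul_le_mul_of_nonneg_left ?_ hp
            nlinarith [pow_nonneg hx 4]
        _ = 2 * ((1 + x) ^ Q * (1 + x) ^ 4) := by ring

lemma continuous_cliquePoly (G : SimpleGraph V) (U : Finset V) :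
    Continuous (G.cliquePoly U) := by
  unfold cliquePoly
  fun_prop

lemma integral_cliquePoly (G : SimpleGraph V) (U : Finset V) :
    ∫ x in (0 : ℝ)..1, G.cliquePoly U x =
      ∑ A ∈ U.powerset.filter (fun A : Finset V => G.IsClique (A : Set V)), 1 / (#A + 1 : ℝ) := by
  unfold cliquePoly
  rw [intervalIntegral.integral_finsetSum
    (fun A _ => (continuous_pow _).intervalIntegrable _ _)]
  refine Finset.sum_congr rfl fun A _ => ?_
  rw [integral_pow]
  simp

end CliquePolynomial

end SimpleGraph

/-! ### Clique weights of vertices -/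

/-- The number `2 ^ (d + 1) - d - 2` of cliques with at least two vertices in `K_{d+1}`, as a real
number. -/
noncomputable def completeCliques (d : ℕ) : ℝ := 2 ^ (d + 1) - d - 2

/-- The number of cliques of `K_{d+1}` per pair (vertex, incident edge). At `d = 0` this is `0`. -/
noncomputable def completeDensity (d : ℕ) : ℝ := completeCliques d / (d * (d + 1))

lemma completeCliques_succ (d : ℕ) :
    completeCliques (d + 1) = 2 * completeCliques d + (d + 1) := by
  simp only [completeCliques]; push_cast; ring

lemma completeCliques_nonneg (d : ℕ) : 0 ≤ completeCliques d := by
  induction d with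
  | zero => norm_num [completeCliques]
  | succ d ih => rw [completeCliques_succ]; positivity

lemma completeCliques_mul_le (d : ℕ) :
    (d + 2 : ℝ) * completeCliques d ≤ d * completeCliques (d + 1) := by
  rcases Nat.lt_or_ge d 2 with h | h
  · interval_cases d <;> norm_num [completeCliques]
  · have hd : (2 : ℝ) ≤ d := by exact_mod_cast h
    have hp : (0 : ℝ) ≤ 2 ^ (d + 1) := by positivity
    rw [completeCliques_succ]
    simp only [completeCliques]
    nlinarith [mul_nonneg (sub_nonneg.2 hd) hp]

lemma completeDensity_mono : Monotone completeDensity := by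
  refine monotone_nat_of_le_succ fun d => ?_
  rcases Nat.eq_zero_or_pos d with rfl | h
  · norm_num [completeDensity, completeCliques]
  · have hd : (0 : ℝ) < d := by exact_mod_cast h
    unfold completeDensity
    rw [div_le_div_iff₀ (by positivity) (by positivity)]
    have := mul_le_mul_of_nonneg_right (completeCliques_mul_le d)
      (by positivity : (0 : ℝ) ≤ d + 1)
    push_cast
    linarith

lemma completeCliques_div_succ (d : ℕ) :
    completeCliques d / (d + 1) = d * completeDensity d := by
  rcases Nat.eq_zero_or_pos d with rfl | h
  · norm_num [completeDensity, completeCliques]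
  · have hd : (0 : ℝ) < d := by exact_mod_cast h
    unfold completeDensity
    field_simp

lemma integral_one_add_pow (n : ℕ) :
    ∫ x in (0 : ℝ)..1, (1 + x) ^ n = (2 ^ (n + 1) - 1) / (n + 1) := by
  rw [intervalIntegral.integral_comp_add_left (fun x => x ^ n) (1 : ℝ), integral_pow]
  norm_num

/-- The left side is the integral of `(1 + x) ^ (r - 1) + x (1 + x) ^ n` over `[0, 1]`, which arises
when the non-edges in `N(T)` contain a spanning star and `|T| = n + 1`. -/
lemma star_integral_le {n r : ℕ} (h : 2 * (n + 1) ≤ r) :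
    (2 ^ r - 1 : ℝ) / r + ((2 ^ (n + 2) - 1) / (n + 2) - (2 ^ (n + 1) - 1) / (n + 1)) ≤
      completeCliques (r - 1) / (r - 1 : ℕ) + 1 := by
  obtain ⟨k, rfl⟩ : ∃ k, r = k + 2 := ⟨r - 2, by omega⟩
  have e1 : (k + 2 : ℕ) - 1 = k + 1 := by omega
  rw [e1]
  have hk : (0 : ℝ) ≤ k := by positivity
  have hn : (0 : ℝ) ≤ n := by positivity
  -- The slack on the right is `completeDensity (r - 1)`, which is monotone in `r`.
  have e2 : completeCliques (k + 1) / (k + 1 : ℕ) + 1 - (2 ^ (k + 2) - 1 : ℝ) / (k + 2 : ℕ) =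
      completeDensity (k + 1) := by
    simp only [completeDensity, completeCliques]
    push_cast
    field_simp
    ring
  have e3 : completeDensity (2 * n + 1) ≤ completeDensity (k + 1) :=
    completeDensity_mono (by omega)
  have e4 : ((2 : ℝ) ^ (n + 2) - 1) / (n + 2) - (2 ^ (n + 1) - 1) / (n + 1) =
      (n * 2 ^ (n + 1) + 1) / ((n + 1) * (n + 2)) := by
    field_simp
    ring
  have e5 : (n * 2 ^ (n + 1) + 1 : ℝ) / ((n + 1) * (n + 2)) ≤ completeDensity (2 * n + 1) := by
    simp only [completeDensity, completeCliques]
    push_cast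
    have hP : (2 : ℝ) ^ (2 * n + 1 + 1) = (2 ^ (n + 1)) ^ 2 := by rw [← pow_mul]; congr 1; ring
    rw [hP, div_le_div_iff₀ (by positivity) (by positivity)]
    rcases Nat.lt_or_ge n 3 with h3 | h3
    · interval_cases n <;> norm_num
    · have hn3 : (3 : ℝ) ≤ n := by exact_mod_cast h3
      have hb : (4 * n + 2 : ℝ) ≤ 2 ^ (n + 1) := by
        clear * - h3
        induction n, h3 using Nat.le_induction with
        | base => norm_num
        | succ m hm ih =>
          have : (3 : ℝ) ≤ m := by exact_mod_cast hm
          rw [pow_succ]; push_cast; linarith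
      set P : ℝ := 2 ^ (n + 1)
      have h1 : (4 * n + 2) * (n * P) ≤ P * (n * P) :=
        mul_le_mul_of_nonneg_right hb (by positivity)
      have h2 : (4 * n + 2 : ℝ) * (4 * n + 2) ≤ P * P :=
        mul_le_mul hb hb (by positivity) (by linarith)
      have h3 : (n * P + 1) * (4 * n + 2) ≤ (P ^ 2 - (2 * n + 1) - 2) * (n + 2) := by
        nlinarith
      have := mul_le_mul_of_nonneg_left h3 (by positivity : (0 : ℝ) ≤ n + 1)
      linarith
  rw [e4]
  linarith

namespace SimpleGraph

section CliqueWeight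

open scoped Classical

variable {V : Type*} [Fintype V]

/-- The weight of a vertex: each clique with at least two vertices gives `1 / |K|` to each of its
vertices. It is written as an integral of the clique polynomial of the neighbourhood, from which
the term of the empty set is removed. -/
noncomputable def cliqueWeight (G : SimpleGraph V) (v : V) : ℝ :=
  (∫ x in (0 : ℝ)..1, G.cliquePoly (G.neighborFinset v) x) - 1

lemma cliqueWeight_eq_sum (G : SimpleGraph V) (v : V) :
    G.cliqueWeight v =
      ∑ K ∈ Finset.univ.filter
        (fun K : Finset V => (G.IsClique (K : Set V) ∧ 2 ≤ #K) ∧ v ∈ K), 1 / (#K : ℝ) := by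
  rw [cliqueWeight, integral_cliquePoly, sub_eq_iff_eq_add,
    ← Finset.sum_erase_add _ _ (a := ∅) (by simp)]
  congr 1
  · refine Finset.sum_bij (fun A _ => insert v A) ?_ ?_ ?_ ?_
    · intro A hA
      simp only [Finset.mem_erase, Finset.mem_filter, Finset.mem_powerset] at hA
      have hvA : v ∉ A := fun h => by simpa using hA.2.1 h
      have hA0 : 1 ≤ #A := Finset.card_pos.2 (Finset.nonempty_iff_ne_empty.2 hA.1)
      simp only [Finset.mem_filter, Finset.mem_univ, true_and, Finset.coe_insert,
        Finset.card_insert_of_notMem hvA, Finset.mem_insert, true_or, and_true]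
      refine ⟨hA.2.2.insert fun b hb _ => ?_, by omega⟩
      simpa using hA.2.1 hb
    · intro A hA B hB h
      simp only [Finset.mem_erase, Finset.mem_filter, Finset.mem_powerset] at hA hB
      have hvA : v ∉ A := fun h => by simpa using hA.2.1 h
      have hvB : v ∉ B := fun h => by simpa using hB.2.1 h
      rw [← Finset.erase_insert hvA, h, Finset.erase_insert hvB]
    · intro K hK
      simp only [Finset.mem_filter, Finset.mem_univ, true_and] at hK
      refine ⟨K.erase v, ?_, Finset.insert_erase hK.2⟩
      simp only [Finset.mem_erase, Finset.mem_filter, Finset.mem_powerset]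
      have hc := Finset.card_erase_add_one hK.2
      refine ⟨fun h => ?_, fun b hb => ?_, hK.1.1.subset (Finset.erase_subset _ _)⟩
      · rw [h] at hc; simp at hc; omega
      · rw [Finset.mem_erase] at hb
        simpa using hK.1.1 hK.2 hb.2 hb.1.symm
    · intro A hA
      simp only [Finset.mem_erase, Finset.mem_filter, Finset.mem_powerset] at hA
      have hvA : v ∉ A := fun h => by simpa using hA.2.1 h
      rw [Finset.card_insert_of_notMem hvA]
      push_cast; rfl
  · simp

lemma numCliques_eq_sum_cliqueWeight (G : SimpleGraph V) :
    (numCliques G : ℝ) = ∑ v, G.cliqueWeight v := by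
  simp_rw [cliqueWeight_eq_sum, Finset.sum_filter _ _, ite_and (_ ∧ _)]
  rw [Finset.sum_comm]
  have h : ∀ K : Finset V, ∑ v, (if G.IsClique (K : Set V) ∧ 2 ≤ #K then
      (if v ∈ K then 1 / (#K : ℝ) else 0) else 0) =
      if G.IsClique (K : Set V) ∧ 2 ≤ #K then 1 else 0 := by
    intro K
    split_ifs with hK
    · have : (#K : ℝ) ≠ 0 := by have := hK.2; positivity
      rw [Finset.sum_ite_mem, Finset.univ_inter, Finset.sum_const, nsmul_eq_mul]
      field_simp
    · simp
  rw [Finset.sum_congr rfl fun K _ => h K, Finset.sum_boole, numCliques,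
    Set.ncard_eq_toFinset_card']
  congr 2
  ext K; simp

lemma cliqueWeight_le_of_degree (G : SimpleGraph V) (v : V) :
    G.cliqueWeight v ≤ G.degree v * completeDensity (G.degree v) := by
  have h : ∫ x in (0 : ℝ)..1, G.cliquePoly (G.neighborFinset v) x ≤
      ∫ x in (0 : ℝ)..1, (1 + x) ^ G.degree v := by
    refine intervalIntegral.integral_mono_on zero_le_one
      ((G.continuous_cliquePoly _).intervalIntegrable _ _)
      ((by fun_prop : Continuous _).intervalIntegrable _ _) fun x hx => ?_
    exact G.cliquePoly_le _ hx.1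
  rw [integral_one_add_pow] at h
  rw [← completeCliques_div_succ, cliqueWeight]
  have : completeCliques (G.degree v) / (G.degree v + 1 : ℝ) =
      (2 ^ (G.degree v + 1) - 1) / (G.degree v + 1) - 1 := by
    simp only [completeCliques]; field_simp; ring
  linarith

/-- A vertex of degree `r` whose neighbourhood splits into `n ≤ r / 2 - 1` vertices and a nonempty
set `S` in which no vertex is adjacent to all others carries at most the weight of `r / (r - 1)`
vertices of `K_r`. -/
lemma cliqueWeight_le_of_cluster (G : SimpleGraph V) {v : V} {r : ℕ} {W S : Finset V}
    (hN : G.neighborFinset v = W ∪ S) (hcard : #W + #S = r) (hW : 2 * (#W + 1) ≤ r)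
    (hS : S.Nonempty) (hS' : ∀ y ∈ S, ∃ z ∈ S, z ≠ y ∧ ¬ G.Adj y z) :
    G.cliqueWeight v ≤ r * completeDensity (r - 1) := by
  have hr : (r : ℝ) * completeDensity (r - 1) = completeCliques (r - 1) / (r - 1 : ℕ) := by
    obtain ⟨k, rfl⟩ : ∃ k, r = k + 2 := ⟨r - 2, by omega⟩
    rw [show k + 2 - 1 = k + 1 by omega, completeDensity]
    push_cast
    field_simp
    ring
  rw [hr]
  have mono : ∀ f : ℝ → ℝ, Continuous f →
      (∀ x : ℝ, 0 ≤ x → x ≤ 1 → G.cliquePoly S x ≤ f x) →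
      G.cliqueWeight v + 1 ≤ ∫ x in (0 : ℝ)..1, (1 + x) ^ #W * f x := by
    intro f hf hle
    rw [cliqueWeight, sub_add_cancel, hN]
    refine intervalIntegral.integral_mono_on zero_le_one
      ((G.continuous_cliquePoly _).intervalIntegrable _ _)
      ((by fun_prop : Continuous _).intervalIntegrable _ _) fun x hx => ?_
    refine (G.cliquePoly_union_le W S hx.1).trans ?_
    exact mul_le_mul_of_nonneg_left (hle x hx.1 hx.2) (pow_nonneg (by linarith [hx.1]) _)
  have target : completeCliques (r - 1) / (r - 1 : ℕ) + 1 =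
      ∫ x in (0 : ℝ)..1, 2 * (1 + x) ^ (r - 2) := by
    rw [intervalIntegral.integral_const_mul, integral_one_add_pow]
    obtain ⟨k, rfl⟩ : ∃ k, r = k + 2 := ⟨r - 2, by omega⟩
    rw [show k + 2 - 1 = k + 1 by omega, show k + 2 - 2 = k by omega, completeCliques]
    push_cast
    field_simp
    ring
  rcases G.cliquePoly_le_of_forall_exists_not_adj hS hS' with ⟨h2, h⟩ | ⟨h2, h⟩ | ⟨h4, h⟩
  · have := mono (fun x => 2 * (1 + x) ^ (#S - 2)) (by fun_prop) h
    have e : ∀ x : ℝ, (1 + x) ^ #W * (2 * (1 + x) ^ (#S - 2)) = 2 * (1 + x) ^ (r - 2) := by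
      intro x
      rw [show r - 2 = #W + (#S - 2) by omega, pow_add]; ring
    simp_rw [e] at this
    linarith
  · have := mono (fun x => (1 + x) ^ (#S - 1) + x) (by fun_prop) fun x hx _ => h x hx
    have e : ∀ x : ℝ, (1 + x) ^ #W * ((1 + x) ^ (#S - 1) + x) =
        (1 + x) ^ (r - 1) + ((1 + x) ^ (#W + 1) - (1 + x) ^ #W) := by
      intro x
      rw [show r - 1 = #W + (#S - 1) by omega, pow_add, pow_succ]; ring
    simp_rw [e] at this
    have int : ∀ k : ℕ, IntervalIntegrable (fun x : ℝ => (1 + x) ^ k) MeasureTheory.volume 0 1 :=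
      fun k => (by fun_prop : Continuous _).intervalIntegrable _ _
    rw [intervalIntegral.integral_add (int _) ((int _).sub (int _)),
      intervalIntegral.integral_sub (int _) (int _), integral_one_add_pow, integral_one_add_pow,
      integral_one_add_pow] at this
    have h' := star_integral_le hW
    rw [show r - 1 + 1 = r by omega, show ((r - 1 : ℕ) : ℝ) + 1 = r by
      rw [← Nat.cast_add_one, show r - 1 + 1 = r by omega]] at this
    push_cast at this
    rw [show (#W : ℝ) + 1 + 1 = #W + 2 by ring] at this
    linarith
  · have := mono (fun x => (1 + 2 * x) ^ 2) (by fun_prop) fun x hx _ => h x hx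
    have hr' : r = #W + 4 := by omega
    have hw : #W ≤ 2 := by omega
    have final : ∫ x in (0 : ℝ)..1, (1 + x) ^ #W * (1 + 2 * x) ^ 2 ≤
        ∫ x in (0 : ℝ)..1, 2 * (1 + x) ^ (r - 2) := by
      rw [hr', intervalIntegral.integral_const_mul, integral_one_add_pow]
      -- In powers of `u = 1 + x` the second factor is `4 u ^ 2 - 4 u + 1`.
      have e : ∀ x : ℝ, (1 + x) ^ #W * (1 + 2 * x) ^ 2 =
          4 * (1 + x) ^ (#W + 2) - 4 * (1 + x) ^ (#W + 1) + (1 + x) ^ #W := by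
        intro x; ring
      simp_rw [e]
      have int : ∀ (c : ℝ) (k : ℕ),
          IntervalIntegrable (fun x : ℝ => c * (1 + x) ^ k) MeasureTheory.volume 0 1 :=
        fun c k => (by fun_prop : Continuous _).intervalIntegrable _ _
      have int' : ∀ k : ℕ,
          IntervalIntegrable (fun x : ℝ => (1 + x) ^ k) MeasureTheory.volume 0 1 :=
        fun k => (by fun_prop : Continuous _).intervalIntegrable _ _
      rw [intervalIntegral.integral_add ((int _ _).sub (int _ _)) (int' _),
        intervalIntegral.integral_sub (int _ _) (int _ _), intervalIntegral.integral_const_mul,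
        intervalIntegral.integral_const_mul, integral_one_add_pow, integral_one_add_pow,
        integral_one_add_pow]
      generalize #W = w at hw
      interval_cases w <;> norm_num
    linarith

end CliqueWeight

end SimpleGraph

/-! ### Clusters and foldings -/

namespace SimpleGraph

section Cluster

open scoped Classical

variable {V : Type*}

lemma folding_adj_of_mem {G : SimpleGraph V} {T : Finset V} (hT : G.IsClique (T : Set V)) {u v : V}
    (hu : u ∈ (T : Set V) ∪ G.commonNbrs T) (hv : v ∈ (T : Set V) ∪ G.commonNbrs T)
    (huv : u ≠ v) : (G.folding T).Adj u v := by
  rw [folding, sdiff_adj, sup_adj]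
  refine ⟨?_, fun h => ?_⟩
  · rcases hu with hu | hu <;> rcases hv with hv | hv
    · exact Or.inl (hT hu hv huv)
    · exact Or.inl (hv u hu)
    · exact Or.inl (hu v hv).symm
    · exact Or.inr ⟨hu, hv, huv⟩
  · rcases h.2 with h | h
    · exact h.2 hv
    · exact h.2 hu

variable [Fintype V]

lemma disjoint_commonNbrs (G : SimpleGraph V) (T : Finset V) :
    Disjoint T (G.commonNbrs T).toFinset := by
  rw [Finset.disjoint_left]
  intro u hu h
  exact G.loopless.irrefl u ((Set.mem_toFinset.1 h) u hu)

/-- If all degrees are at most `r`, then every vertex of a tight clique `T` has closed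
neighbourhood `T ∪ N(T)`. -/
lemma IsTightClique.neighborFinset_eq {G : SimpleGraph V} {r : ℕ} {T : Finset V}
    (hT : G.IsTightClique r T) (hdeg : ∀ v, G.degree v ≤ r) {u : V} (hu : u ∈ T) :
    G.neighborFinset u = T.erase u ∪ (G.commonNbrs T).toFinset := by
  symm
  apply Finset.eq_of_subset_of_card_le
  · intro w hw
    rw [mem_neighborFinset]
    rcases Finset.mem_union.1 hw with h | h
    · rw [Finset.mem_erase] at h
      exact hT.2.1 hu h.2 h.1.symm
    · exact (Set.mem_toFinset.1 h) u hu
  · rw [Finset.card_union_of_disjoint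
      ((G.disjoint_commonNbrs T).mono_left (Finset.erase_subset _ _)),
      Finset.card_erase_of_mem hu, card_neighborFinset_eq_degree, ← Set.ncard_eq_toFinset_card']
    have := hdeg u
    have := hT.2.2
    have := Finset.card_pos.2 ⟨u, hu⟩
    omega

lemma exists_isCluster_mem (G : SimpleGraph V) {v : V} :
    ∃ T, G.IsCluster (G.degree v) T ∧ v ∈ T := by
  have h : G.IsTightClique (G.degree v) {v} := by
    refine ⟨by simp, by simp, ?_⟩
    have : G.commonNbrs {v} = (G.neighborFinset v : Set V) := by
      ext w; simp [commonNbrs]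
    rw [this, Set.ncard_coe_finset, card_neighborFinset_eq_degree, Finset.card_singleton]
  obtain ⟨T, hT, hmax⟩ := (Set.toFinite {T | G.IsTightClique (G.degree v) T}).exists_le_maximal h
  exact ⟨T, hmax, hT (by simp)⟩

/-- By maximality of a cluster `T`, no vertex of `N(T)` is adjacent to all the others. -/
lemma IsCluster.exists_not_adj {G : SimpleGraph V} {r : ℕ} {T : Finset V}
    (hT : G.IsCluster r T) {y : V} (hy : y ∈ (G.commonNbrs T).toFinset) :
    ∃ z ∈ (G.commonNbrs T).toFinset, z ≠ y ∧ ¬ G.Adj y z := by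
  by_contra! hcon
  have hyT : y ∉ T := fun h => Finset.disjoint_left.1 (G.disjoint_commonNbrs T) h hy
  have hy' : y ∈ G.commonNbrs T := Set.mem_toFinset.1 hy
  have hset : (G.commonNbrs (insert y T)).toFinset = (G.commonNbrs T).toFinset.erase y := by
    ext z
    simp only [Set.mem_toFinset, Finset.mem_erase]
    constructor
    · intro h
      exact ⟨(h y (Finset.mem_insert_self _ _)).ne', fun u hu => h u (Finset.mem_insert_of_mem hu)⟩
    · rintro ⟨hne, h⟩ u hu
      rcases Finset.mem_insert.1 hu with rfl | hu
      · exact hcon z (Set.mem_toFinset.2 h) hne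
      · exact h u hu
  have htight : G.IsTightClique r (insert y T) := by
    refine ⟨Finset.insert_nonempty _ _, ?_, ?_⟩
    · rw [Finset.coe_insert]
      exact hT.prop.2.1.insert fun b hb _ => (hy' b hb).symm
    · have h1 := hT.prop.2.2
      rw [Set.ncard_eq_toFinset_card'] at h1 ⊢
      rw [hset, Finset.card_erase_of_mem hy, Finset.card_insert_of_notMem hyT]
      have := Finset.card_pos.2 ⟨y, hy⟩
      omega
  exact hyT (hT.le_of_ge htight (Finset.subset_insert _ _) (Finset.mem_insert_self _ _))

/-- A tight clique without common neighbours is a connected component. -/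
lemma IsTightClique.commonNbrs_nonempty {G : SimpleGraph V} {r : ℕ} {T : Finset V}
    (hT : G.IsTightClique r T) (hdeg : ∀ v, G.degree v ≤ r) (hconn : G.Connected)
    (htop : G ≠ ⊤) : (G.commonNbrs T).toFinset.Nonempty := by
  rw [Finset.nonempty_iff_ne_empty]
  intro hS
  have hstep : ∀ u ∈ T, ∀ w, G.Adj u w → w ∈ T := by
    intro u hu w huw
    rw [← mem_neighborFinset, hT.neighborFinset_eq hdeg hu, hS, Finset.union_empty] at huw
    exact Finset.mem_of_mem_erase huw
  obtain ⟨u, hu⟩ := hT.1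
  have hall : ∀ w, w ∈ T := by
    intro w
    obtain ⟨p⟩ := hconn.preconnected u w
    induction p with
    | nil => exact hu
    | cons h _ ih => exact ih (hstep _ hu _ h)
  apply htop
  ext a b
  rw [top_adj]
  exact ⟨fun h => h.ne, fun h => hT.2.1 (hall a) (hall b) h⟩

/-- Each `v ∈ N(T)` has at most as many neighbours outside `T ∪ N(T)` as it has non-neighbours
in `N(T)`. -/
lemma IsTightClique.card_blue_le {G : SimpleGraph V} {r : ℕ} {T : Finset V}
    (hT : G.IsTightClique r T) (hdeg : ∀ v, G.degree v ≤ r) {v : V}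
    (hv : v ∈ (G.commonNbrs T).toFinset) :
    #((G.neighborFinset v).filter fun w => w ∉ T ∧ w ∉ (G.commonNbrs T).toFinset) ≤
      #((G.commonNbrs T).toFinset.filter fun w => w ≠ v ∧ ¬ G.Adj v w) := by
  set S := (G.commonNbrs T).toFinset
  have hsub : T ∪ S.filter (G.Adj v) ∪
      (G.neighborFinset v).filter (fun w => w ∉ T ∧ w ∉ S) ⊆ G.neighborFinset v := by
    intro w hw
    simp only [Finset.mem_union, Finset.mem_filter, mem_neighborFinset] at hw ⊢
    rcases hw with (h | h) | h
    · exact ((Set.mem_toFinset.1 hv) w h).symm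
    · exact h.2
    · exact h.1
  have hd := Finset.card_le_card hsub
  rw [Finset.card_union_of_disjoint, Finset.card_union_of_disjoint,
    card_neighborFinset_eq_degree] at hd
  · have h1 := Finset.card_filter_add_card_filter_not (s := S) (G.Adj v)
    have h2 : S.filter (fun w => ¬ G.Adj v w) =
        insert v (S.filter fun w => w ≠ v ∧ ¬ G.Adj v w) := by
      ext w
      simp only [Finset.mem_filter, Finset.mem_insert]
      constructor
      · intro h
        by_cases hw : w = v
        · exact Or.inl hw
        · exact Or.inr ⟨h.1, hw, h.2⟩
      · rintro (rfl | h)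
        · exact ⟨hv, G.loopless.irrefl _⟩
        · exact ⟨h.1, h.2.2⟩
    rw [h2, Finset.card_insert_of_notMem (by simp)] at h1
    have h3 := hT.2.2
    rw [Set.ncard_eq_toFinset_card'] at h3
    have := hdeg v
    change #S + #T = r + 1 at h3
    omega
  · exact (G.disjoint_commonNbrs T).mono_right (Finset.filter_subset _ _)
  · rw [Finset.disjoint_left]
    intro w hw hw'
    simp only [Finset.mem_union, Finset.mem_filter] at hw hw'
    rcases hw with h | h
    · exact hw'.2.1 h
    · exact hw'.2.2 h.1

/-- A clique destroyed by folding at `T` consists of a nonempty part in `N(T)` and a nonempty part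
outside `T ∪ N(T)`. -/
lemma exists_mem_of_not_isClique_folding {G : SimpleGraph V} {r : ℕ} {T K : Finset V}
    (hT : G.IsTightClique r T) (hdeg : ∀ v, G.degree v ≤ r) (hK : G.IsClique (K : Set V))
    (hK' : ¬ (G.folding T).IsClique (K : Set V)) :
    Disjoint K T ∧ ∃ v ∈ K, v ∈ (G.commonNbrs T).toFinset ∧
      ∃ w ∈ K, w ∉ T ∧ w ∉ (G.commonNbrs T).toFinset := by
  have h : ∃ v ∈ K, v ∈ (G.commonNbrs T).toFinset ∧
      ∃ w ∈ K, w ∉ T ∧ w ∉ (G.commonNbrs T).toFinset := by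
    simp only [IsClique, Set.Pairwise] at hK'
    push Not at hK'
    obtain ⟨a, ha, b, hb, hab, hn⟩ := hK'
    have hadj := hK ha hb hab
    rw [folding, sdiff_adj, sup_adj] at hn
    have hblue : (G.blueGraph T).Adj a b := by
      by_contra hc
      exact hn ⟨Or.inl hadj, hc⟩
    rcases hblue.2 with h | h
    · exact ⟨a, ha, Set.mem_toFinset.2 h.1, b, hb, fun h' => h.2 (Or.inl h'),
        fun h' => h.2 (Or.inr (Set.mem_toFinset.1 h'))⟩
    · exact ⟨b, hb, Set.mem_toFinset.2 h.1, a, ha, fun h' => h.2 (Or.inl h'),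
        fun h' => h.2 (Or.inr (Set.mem_toFinset.1 h'))⟩
  refine ⟨?_, h⟩
  obtain ⟨_, _, _, w, hw, hwT, hwS⟩ := h
  rw [Finset.disjoint_left]
  intro u hu huT
  have huw : G.Adj u w := hK hu hw fun e => hwT (e ▸ huT)
  rw [← mem_neighborFinset, hT.neighborFinset_eq hdeg huT, Finset.mem_union] at huw
  exact huw.elim (fun h => hwT (Finset.mem_of_mem_erase h)) hwS

/-- Folding at an unfoldable tight clique `T` creates at least `2 ^ |T|` cliques for every
non-clique `D ⊆ N(T)`, and it destroys at most `|N(T)|` cliques for every such `D`: a destroyed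
clique `A ∪ B` with `A ⊆ N(T)` and `B` outside is encoded by a vertex `v ∈ A` and the non-clique
`A ∪ φ_v(B)`, where `φ_v` injects the outside neighbours of `v` into its non-neighbours
in `N(T)`. -/
lemma IsUnfoldable.two_pow_card_le {G : SimpleGraph V} {r : ℕ} {T : Finset V}
    (hU : G.IsUnfoldable T) (hT : G.IsTightClique r T) (hdeg : ∀ v, G.degree v ≤ r)
    (hS : ∃ y ∈ (G.commonNbrs T).toFinset, ∃ z ∈ (G.commonNbrs T).toFinset, z ≠ y ∧
      ¬ G.Adj y z) : 2 ^ #T ≤ #(G.commonNbrs T).toFinset := by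
  set S := (G.commonNbrs T).toFinset with hSdef
  have hTS : Disjoint T S := G.disjoint_commonNbrs T
  set C : Finset (Finset V) := Finset.univ.filter fun K => G.IsClique (K : Set V) ∧ 2 ≤ #K with hC
  set C' : Finset (Finset V) :=
    Finset.univ.filter fun K => (G.folding T).IsClique (K : Set V) ∧ 2 ≤ #K with hC'
  set D : Finset (Finset V) := S.powerset.filter fun K => ¬ G.IsClique (K : Set V) with hD
  have hcount : #(C' \ C) ≤ #(C \ C') := by
    rw [Finset.card_sdiff_le_card_sdiff_iff]
    have hU' := hU
    unfold IsUnfoldable numCliques at hU'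
    rw [Set.ncard_eq_toFinset_card', Set.ncard_eq_toFinset_card'] at hU'
    convert hU' using 2 <;> (ext K; simp [hC, hC'])
  have hnew : 2 ^ #T * #D ≤ #(C' \ C) := by
    rw [← Finset.card_powerset, ← Finset.card_product]
    refine Finset.card_le_card_of_injOn (fun p => p.1 ∪ p.2) ?_ ?_
    · rintro ⟨A, B⟩ hp
      simp only [hD, Finset.coe_product, Set.mem_prod, Finset.mem_coe, Finset.mem_powerset,
        Finset.mem_filter] at hp
      obtain ⟨hA, hB, hB'⟩ := hp
      have hn : ¬ G.IsClique ((A ∪ B : Finset V) : Set V) := fun h =>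
        hB' (h.subset (by exact_mod_cast Finset.subset_union_right))
      have h2 : 2 ≤ #(A ∪ B) := by
        by_contra hlt
        refine hn fun a ha b hb hab => absurd (Finset.one_lt_card.2 ⟨a, ha, b, hb, hab⟩) (by omega)
      simp only [hC, hC', Finset.coe_sdiff, Finset.coe_filter, Set.mem_sdiff, Set.mem_ofPred_eq,
        Finset.mem_univ, true_and]
      refine ⟨⟨fun a ha b hb hab => folding_adj_of_mem hT.2.1 ?_ ?_ hab, h2⟩, fun h => hn h.1⟩
      · rcases Finset.mem_union.1 ha with h | h
        · exact Or.inl (hA h)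
        · exact Or.inr (Set.mem_toFinset.1 (hB h))
      · rcases Finset.mem_union.1 hb with h | h
        · exact Or.inl (hA h)
        · exact Or.inr (Set.mem_toFinset.1 (hB h))
    · rintro ⟨A, B⟩ hp ⟨A', B'⟩ hp' heq
      simp only [hD, Finset.coe_product, Set.mem_prod, Finset.mem_coe, Finset.mem_powerset,
        Finset.mem_filter] at hp hp'
      dsimp only at heq
      have rec1 : ∀ A B : Finset V, A ⊆ T → B ⊆ S → (A ∪ B) ∩ T = A ∧ (A ∪ B) ∩ S = B := by
        intro A B hA hB
        rw [Finset.union_inter_distrib_right, Finset.union_inter_distrib_right,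
          Finset.inter_eq_left.2 hA, Finset.inter_eq_left.2 hB,
          Finset.disjoint_iff_inter_eq_empty.1 (hTS.symm.mono_left hB),
          Finset.disjoint_iff_inter_eq_empty.1 (hTS.mono_left hA)]
        simp
      have h1 := rec1 A B hp.1 hp.2.1
      have h2 := rec1 A' B' hp'.1 hp'.2.1
      rw [heq] at h1
      exact Prod.ext (h1.1.symm.trans h2.1) (h1.2.symm.trans h2.2)
  have hold : #(C \ C') ≤ #S * #D := by
    have hphi : ∀ v : V, ∃ φ : V → V, v ∈ S →
        (∀ w, G.Adj v w → w ∉ T → w ∉ S → φ w ∈ S ∧ φ w ≠ v ∧ ¬ G.Adj v (φ w)) ∧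
        Set.InjOn φ {w | G.Adj v w ∧ w ∉ T ∧ w ∉ S} := by
      intro v
      by_cases hv : v ∈ S
      · have : Nonempty V := ⟨v⟩
        have hle := hT.card_blue_le hdeg hv
        rw [← Nat.cast_le (α := ℕ∞), ← Set.encard_coe_eq_coe_finsetCard,
          ← Set.encard_coe_eq_coe_finsetCard] at hle
        obtain ⟨φ, h1, h2⟩ := (Finset.finite_toSet _).exists_injOn_of_encard_le hle
        refine ⟨φ, fun _ => ⟨fun w h3 h4 h5 => ?_, h2.mono fun w hw => ?_⟩⟩
        · have hw : w ∈ (G.neighborFinset v).filter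
              fun w => w ∉ T ∧ w ∉ (G.commonNbrs T).toFinset := by
            rw [Finset.mem_filter, mem_neighborFinset]
            exact ⟨h3, h4, h5⟩
          exact Finset.mem_filter.1 (h1 (Finset.mem_coe.2 hw))
        · rw [Finset.mem_coe, Finset.mem_filter, mem_neighborFinset]
          exact hw
      · exact ⟨id, fun h => absurd h hv⟩
    choose φ hφ using hphi
    have hrep : ∀ K : Finset V, ∃ v, K ∈ C \ C' → v ∈ K ∧ v ∈ S := by
      intro K
      by_cases hK : K ∈ C \ C'
      · simp only [hC, hC', Finset.mem_sdiff, Finset.mem_filter, Finset.mem_univ, true_and] at hK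
        obtain ⟨-, v, hv, hvS, -⟩ := exists_mem_of_not_isClique_folding hT hdeg hK.1.1
          fun h => hK.2 ⟨h, hK.1.2⟩
        exact ⟨v, fun _ => ⟨hv, hvS⟩⟩
      · exact ⟨hT.1.choose, fun h => absurd h hK⟩
    choose rep hrep using hrep
    have hmem : ∀ K ∈ C \ C', G.IsClique (K : Set V) ∧ Disjoint K T ∧ (K \ S).Nonempty := by
      intro K hK
      simp only [hC, hC', Finset.mem_sdiff, Finset.mem_filter, Finset.mem_univ, true_and] at hK
      obtain ⟨hd, v, hv, hvS, w, hw, hwT, hwS⟩ :=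
        exists_mem_of_not_isClique_folding hT hdeg hK.1.1 fun h => hK.2 ⟨h, hK.1.2⟩
      exact ⟨hK.1.1, hd, w, Finset.mem_sdiff.2 ⟨hw, hwS⟩⟩
    -- Outside vertices of a destroyed clique are in the domain of `φ (rep K)`.
    have hout : ∀ K ∈ C \ C', ∀ w ∈ K \ S, G.Adj (rep K) w ∧ w ∉ T ∧ w ∉ S := by
      intro K hK w hw
      rw [Finset.mem_sdiff] at hw
      obtain ⟨hc, hd, -⟩ := hmem K hK
      have hr := hrep K hK
      exact ⟨hc hr.1 hw.1 fun e => hw.2 (e ▸ hr.2), fun h => Finset.disjoint_left.1 hd hw.1 h,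
        hw.2⟩
    rw [← Finset.card_product]
    refine Finset.card_le_card_of_injOn
      (fun K => (rep K, (K ∩ S) ∪ (K \ S).image (φ (rep K)))) ?_ ?_
    · intro K hK
      rw [Finset.mem_coe] at hK
      obtain ⟨hc, hd, w, hw⟩ := hmem K hK
      have hr := hrep K hK
      simp only [hD, Finset.coe_product, Set.mem_prod, Finset.mem_coe, Finset.mem_powerset,
        Finset.mem_filter]
      refine ⟨hr.2, ?_, fun hcl => ?_⟩
      · refine Finset.union_subset Finset.inter_subset_right ?_
        intro z hz
        obtain ⟨w, hw, rfl⟩ := Finset.mem_image.1 hz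
        have ho := hout K hK w hw
        exact ((hφ _ hr.2).1 w ho.1 ho.2.1 ho.2.2).1
      · have ho := hout K hK w hw
        have hφw := (hφ _ hr.2).1 w ho.1 ho.2.1 ho.2.2
        refine hφw.2.2 (hcl ?_ ?_ hφw.2.1.symm)
        · exact_mod_cast Finset.mem_union_left _ (Finset.mem_inter.2 hr)
        · exact_mod_cast Finset.mem_union_right _ (Finset.mem_image_of_mem _ hw)
    · intro K hK K' hK' heq
      rw [Finset.mem_coe] at hK hK'
      obtain ⟨hv, hset⟩ := Prod.ext_iff.1 heq
      dsimp only at hv hset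
      -- The part in `N(T)` and the image of the outside part are told apart by adjacency to `v`.
      have rec1 : ∀ K ∈ C \ C', ∀ z, z ∈ K ∩ S ↔ z ∈ (K ∩ S) ∪ (K \ S).image (φ (rep K)) ∧
          (z = rep K ∨ G.Adj (rep K) z) := by
        intro K hK z
        obtain ⟨hc, -, -⟩ := hmem K hK
        have hr := hrep K hK
        constructor
        · intro hz
          refine ⟨Finset.mem_union_left _ hz, ?_⟩
          by_cases he : z = rep K
          · exact Or.inl he
          · exact Or.inr (hc hr.1 (Finset.mem_inter.1 hz).1 (Ne.symm he))
        · rintro ⟨hz, ha⟩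
          rcases Finset.mem_union.1 hz with h | h
          · exact h
          · obtain ⟨w, hw, rfl⟩ := Finset.mem_image.1 h
            have ho := hout K hK w hw
            have hφw := (hφ _ hr.2).1 w ho.1 ho.2.1 ho.2.2
            exact absurd ha (not_or.2 hφw.2)
      have rec2 : ∀ K ∈ C \ C', ∀ w, w ∈ K \ S ↔ (G.Adj (rep K) w ∧ w ∉ T ∧ w ∉ S) ∧
          φ (rep K) w ∈ (K ∩ S) ∪ (K \ S).image (φ (rep K)) := by
        intro K hK w
        obtain ⟨hc, -, -⟩ := hmem K hK
        have hr := hrep K hK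
        constructor
        · intro hw
          exact ⟨hout K hK w hw, Finset.mem_union_right _ (Finset.mem_image_of_mem _ hw)⟩
        · rintro ⟨ho, hm⟩
          have hφw := (hφ _ hr.2).1 w ho.1 ho.2.1 ho.2.2
          rcases Finset.mem_union.1 hm with h | h
          · exact absurd (((rec1 K hK _).1 h).2) (not_or.2 hφw.2)
          · obtain ⟨w', hw', he⟩ := Finset.mem_image.1 h
            rwa [← (hφ _ hr.2).2 (hout K hK w' hw') ho he]
      rw [← Finset.sdiff_union_inter K S, ← Finset.sdiff_union_inter K' S]
      congr 1
      · ext w; rw [rec2 K hK, rec2 K' hK', hset, hv]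
      · ext z; rw [rec1 K hK, rec1 K' hK', hset, hv]
  have hDpos : 0 < #D := by
    obtain ⟨y, hy, z, hz, hne, hyz⟩ := hS
    refine Finset.card_pos.2 ⟨{y, z}, ?_⟩
    simp only [hD, Finset.mem_filter, Finset.mem_powerset]
    refine ⟨fun a ha => ?_, fun h => hyz (h (by simp) (by simp) hne.symm)⟩
    rcases Finset.mem_insert.1 ha with rfl | ha
    · exact hy
    · rw [Finset.mem_singleton.1 ha]; exact hz
  exact Nat.le_of_mul_le_mul_right (hnew.trans (hcount.trans hold)) hDpos

end Cluster

end SimpleGraph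

/-! ### The extremal graph -/

section ExtremalGraph

open scoped Classical

variable {V W : Type*}

lemma numCliques_le_of_embedding {G : SimpleGraph V} {H : SimpleGraph W} (f : G ↪g H)
    (hfin : {K : Finset W | H.IsClique (K : Set W) ∧ 2 ≤ #K}.Finite) :
    numCliques G ≤ numCliques H := by
  refine Set.ncard_le_ncard_of_injOn (fun K => K.map f.toEmbedding) ?_ ?_ hfin
  · rintro K ⟨hK, h2⟩
    refine ⟨?_, by rwa [Finset.card_map]⟩
    rintro a ha b hb hab
    simp only [Finset.coe_map, Set.mem_image] at ha hb
    obtain ⟨a, ha, rfl⟩ := ha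
    obtain ⟨b, hb, rfl⟩ := hb
    exact f.map_adj_iff.2 (hK ha hb fun h => hab (by rw [h]))
  · intro K _ K' _ h
    exact Finset.map_injective _ h

lemma card_powerset_filter_two_le {α : Type*} (s : Finset α) :
    #(s.powerset.filter fun A => 2 ≤ #A) + #s + 1 = 2 ^ #s := by
  have h1 := Finset.card_filter_add_card_filter_not (s := s.powerset) (fun A => 2 ≤ #A)
  have h2 : s.powerset.filter (fun A => ¬ 2 ≤ #A) = s.powersetCard 0 ∪ s.powersetCard 1 := by
    ext A
    simp only [Finset.mem_filter, Finset.mem_powerset, Finset.mem_union, Finset.mem_powersetCard,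
      ← and_or_left]
    refine and_congr_right fun _ => by omega
  rw [h2, Finset.card_union_of_disjoint, Finset.card_powersetCard, Finset.card_powersetCard,
    Finset.card_powerset, Nat.choose_zero_right, Nat.choose_one_right] at h1
  · omega
  · exact Finset.pairwise_disjoint_powersetCard s (by simp)

lemma two_pow_card_le_numCliques [Fintype V] {G : SimpleGraph V} {s : Finset V}
    (hs : G.IsClique (s : Set V)) : 2 ^ #s ≤ numCliques G + #s + 1 := by
  rw [← card_powerset_filter_two_le, add_le_add_iff_right, add_le_add_iff_right, numCliques,
    ← Set.ncard_coe_finset]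
  refine Set.ncard_le_ncard ?_ (Set.toFinite _)
  intro A hA
  simp only [Finset.coe_filter, Finset.mem_powerset, Set.mem_ofPred_eq] at hA ⊢
  exact ⟨hs.subset (by exact_mod_cast hA.1), hA.2⟩

lemma card_edgeFinset_le_numCliques [Fintype V] (G : SimpleGraph V) :
    #G.edgeFinset ≤ numCliques G := by
  rw [numCliques, ← Set.ncard_coe_finset]
  refine Set.ncard_le_ncard_of_injOn (fun e => e.toFinset) ?_ ?_ (Set.toFinite _)
  · intro e he
    rw [SimpleGraph.coe_edgeFinset] at he
    refine ⟨?_, (Sym2.card_toFinset_of_not_isDiag e (G.not_isDiag_of_mem_edgeSet he)).ge⟩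
    induction e with | _ a b =>
    intro x hx y hy hxy
    have hab : G.Adj a b := he
    simp only [Finset.mem_coe, Sym2.mem_toFinset, Sym2.mem_iff] at hx hy
    rcases hx with rfl | rfl <;> rcases hy with rfl | rfl
    · exact absurd rfl hxy
    · exact hab
    · exact hab.symm
    · exact absurd rfl hxy
  · intro e _ e' _ h
    refine Sym2.ext fun x => ?_
    rw [← Sym2.mem_toFinset, ← Sym2.mem_toFinset]
    exact iff_of_eq (congrArg (x ∈ ·) h)

lemma numCliques_add_le_sum [Fintype V] [Fintype W] (G : SimpleGraph V) (H : SimpleGraph W) :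
    numCliques G + numCliques H ≤ numCliques (G.sum H) := by
  have hl := Set.ncard_image_of_injective {K : Finset V | G.IsClique (K : Set V) ∧ 2 ≤ #K}
    (Finset.map_injective (Function.Embedding.inl : V ↪ V ⊕ W))
  have hr := Set.ncard_image_of_injective {K : Finset W | H.IsClique (K : Set W) ∧ 2 ≤ #K}
    (Finset.map_injective (Function.Embedding.inr : W ↪ V ⊕ W))
  unfold numCliques
  rw [← hl, ← hr, ← Set.ncard_union_eq]
  · refine Set.ncard_le_ncard ?_ (Set.toFinite _)
    rintro _ (⟨K, ⟨hK, h2⟩, rfl⟩ | ⟨K, ⟨hK, h2⟩, rfl⟩)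
    all_goals
      refine ⟨?_, by rwa [Finset.card_map]⟩
      rintro a ha b hb hab
      simp only [Finset.coe_map, Set.mem_image] at ha hb
      obtain ⟨a, ha, rfl⟩ := ha
      obtain ⟨b, hb, rfl⟩ := hb
      simpa using hK ha hb fun h => hab (by rw [h])
  · rw [Set.disjoint_left]
    rintro _ ⟨K, ⟨hK, h2⟩, rfl⟩ ⟨K', -, h⟩
    obtain ⟨a, ha⟩ := Finset.card_pos.1 (by omega : 0 < #K)
    have : Sum.inl a ∈ K'.map (Function.Embedding.inr : W ↪ V ⊕ W) := by
      rw [h]; exact Finset.mem_map_of_mem _ ha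
    simp at this

lemma le_numCliques_copiesComplete (a r : ℕ) :
    a * completeCliques r ≤ numCliques (copiesComplete a (r + 1)) := by
  have h : a * #((Finset.univ : Finset (Fin (r + 1))).powerset.filter fun A => 2 ≤ #A) ≤
      numCliques (copiesComplete a (r + 1)) := by
    conv_lhs => rw [← Fintype.card_fin a, ← Finset.card_univ, ← Finset.card_product]
    rw [numCliques, ← Set.ncard_coe_finset]
    refine Set.ncard_le_ncard_of_injOn (fun p => p.2.map (Function.Embedding.sectR p.1 _)) ?_ ?_
      (Set.toFinite _)
    · rintro ⟨i, A⟩ hA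
      simp only [Finset.coe_product, Set.mem_prod, Finset.mem_coe, Finset.mem_filter] at hA
      refine ⟨?_, by rw [Finset.card_map]; exact hA.2.2⟩
      rintro x hx y hy hxy
      simp only [Finset.coe_map, Set.mem_image] at hx hy
      obtain ⟨x, hx, rfl⟩ := hx
      obtain ⟨y, hy, rfl⟩ := hy
      exact ⟨rfl, fun h => hxy (by rw [show x = y from h])⟩
    · rintro ⟨i, A⟩ hA ⟨j, B⟩ hB h
      simp only [Finset.coe_product, Set.mem_prod, Finset.mem_coe, Finset.mem_filter] at hA hB
      dsimp only at h
      obtain ⟨x, hx⟩ := Finset.card_pos.1 (by omega : 0 < #A)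
      have hij : i = j := by
        have : (i, x) ∈ B.map (Function.Embedding.sectR j _) := by
          rw [← h]; exact Finset.mem_map_of_mem (Function.Embedding.sectR i _) hx
        obtain ⟨y, _, hy⟩ := Finset.mem_map.1 this
        exact (congrArg Prod.fst hy).symm
      subst hij
      rw [Finset.map_injective _ h]
  have hc := card_powerset_filter_two_le (Finset.univ : Finset (Fin (r + 1)))
  rw [Finset.card_univ, Fintype.card_fin] at hc
  have hc' : (#((Finset.univ : Finset (Fin (r + 1))).powerset.filter fun A => 2 ≤ #A) : ℝ) =
      completeCliques r := by
    have : (#((Finset.univ : Finset (Fin (r + 1))).powerset.filter fun A => 2 ≤ #A) : ℝ)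
      + (r + 1) + 1 = 2 ^ (r + 1) := by exact_mod_cast hc
    rw [completeCliques]; linarith
  rw [← hc']
  exact_mod_cast h

/-- The colex graph restricted to the vertices `0, …, r`; it contains all edges of `𝒞(b)` as long
as `b ≤ (r + 1).choose 2`. -/
def truncatedColex (r b : ℕ) : SimpleGraph (Fin (r + 1)) :=
  (colexGraph b).comap Fin.val

lemma choose_two_succ (k : ℕ) : (k + 1).choose 2 = k.choose 2 + k := by
  rw [Nat.choose_succ_succ' k 1, Nat.choose_one_right, add_comm]

/-- Below `k`, the vertex `y` has `min y (b - y.choose 2)` smaller neighbours in `𝒞(b)`. -/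
lemma sum_min_choose_two (b k : ℕ) :
    ∑ y ∈ Finset.range k, min y (b - y.choose 2) = min b (k.choose 2) := by
  induction k with
  | zero => simp
  | succ k ih => rw [Finset.sum_range_succ, ih, choose_two_succ]; omega

lemma card_edgeFinset_truncatedColex {r b : ℕ} (hb : b ≤ (r + 1).choose 2) :
    #(truncatedColex r b).edgeFinset = b := by
  have h : #((Finset.range (r + 1)).sigma fun y => Finset.range (min y (b - y.choose 2))) = b := by
    rw [Finset.card_sigma]
    simp only [Finset.card_range]
    rw [sum_min_choose_two, min_eq_left hb]
  conv_rhs => rw [← h]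
  symm
  have hlt : ∀ p ∈ (Finset.range (r + 1)).sigma fun y => Finset.range (min y (b - y.choose 2)),
      p.1 < r + 1 ∧ p.2 < p.1 ∧ p.1.choose 2 + p.2 < b := by
    intro p hp
    simp only [Finset.mem_sigma, Finset.mem_range] at hp
    omega
  refine Finset.card_bij
    (fun p hp => s(⟨p.1, (hlt p hp).1⟩, ⟨p.2, (hlt p hp).2.1.trans (hlt p hp).1⟩)) ?_ ?_ ?_
  · intro p hp
    obtain ⟨-, h2, h3⟩ := hlt p hp
    rw [SimpleGraph.mem_edgeFinset, SimpleGraph.mem_edgeSet]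
    refine ⟨h2.ne', ?_⟩
    rwa [max_eq_left h2.le, min_eq_right h2.le]
  · rintro ⟨y, x⟩ hp ⟨y', x'⟩ hp' heq
    obtain ⟨-, h2, -⟩ := hlt _ hp
    obtain ⟨-, h2', -⟩ := hlt _ hp'
    dsimp only at h2 h2'
    simp only [Sym2.eq_iff, Fin.mk.injEq] at heq
    obtain ⟨rfl, rfl⟩ : y = y' ∧ x = x' := by omega
    rfl
  · intro e he
    induction e with | _ u v =>
    rw [SimpleGraph.mem_edgeFinset, SimpleGraph.mem_edgeSet] at he
    have key : ∀ u v : Fin (r + 1), v < u → (truncatedColex r b).Adj u v →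
        ∃ p, ∃ hp : p ∈ (Finset.range (r + 1)).sigma
          (fun y => Finset.range (min y (b - y.choose 2))),
          s(⟨p.1, (hlt p hp).1⟩, ⟨p.2, (hlt p hp).2.1.trans (hlt p hp).1⟩) = s(u, v) := by
      intro u v huv hadj
      have h3 : (u : ℕ).choose 2 + (v : ℕ) < b := by
        have := hadj.2
        rwa [max_eq_left (Fin.le_def.1 huv.le), min_eq_right (Fin.le_def.1 huv.le)] at this
      have h4 : (v : ℕ) < u := huv
      refine ⟨⟨u, v⟩, ?_, rfl⟩
      simp only [Finset.mem_sigma, Finset.mem_range]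
      have := u.2
      omega
    rcases lt_or_gt_of_ne he.ne with h | h
    · obtain ⟨p, hp, e⟩ := key v u h he.symm
      exact ⟨p, hp, e.trans Sym2.eq_swap⟩
    · exact key u v h he

lemma degree_copiesComplete (a r : ℕ) (p : Fin a × Fin (r + 1)) :
    (copiesComplete a (r + 1)).degree p = r := by
  have : (copiesComplete a (r + 1)).neighborFinset p =
      (Finset.univ.erase p.2).map (Function.Embedding.sectR p.1 _) := by
    ext q
    simp only [SimpleGraph.mem_neighborFinset, Finset.mem_map, Finset.mem_erase, Finset.mem_univ,
      and_true]
    constructor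
    · rintro ⟨h1, h2⟩
      exact ⟨q.2, h2.symm, by rw [Function.Embedding.sectR_apply, h1]⟩
    · rintro ⟨x, hx, rfl⟩
      exact ⟨rfl, hx.symm⟩
  rw [← SimpleGraph.card_neighborFinset_eq_degree, this, Finset.card_map,
    Finset.card_erase_of_mem (Finset.mem_univ _), Finset.card_univ, Fintype.card_fin]
  rfl

lemma card_edgeFinset_copiesComplete (a r : ℕ) :
    #(copiesComplete a (r + 1)).edgeFinset = a * (r + 1).choose 2 := by
  have h := (copiesComplete a (r + 1)).sum_degrees_eq_twice_card_edges
  simp only [degree_copiesComplete, Finset.sum_const, Finset.card_univ, Fintype.card_prod,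
    Fintype.card_fin, smul_eq_mul] at h
  have h2 : (r + 1).choose 2 * 2 = (r + 1) * r := by
    clear h
    induction r with
    | zero => rfl
    | succ r ih => rw [choose_two_succ, add_mul, ih]; ring
  refine Nat.eq_of_mul_eq_mul_left two_pos ?_
  rw [← h, mul_comm 2, mul_assoc, mul_assoc, h2]

/-- A copy of `a K_{r+1} ∪ 𝒞(b)` on a finite vertex set. -/
def extremalGraph (a r b : ℕ) : SimpleGraph ((Fin a × Fin (r + 1)) ⊕ Fin (r + 1)) :=
  (copiesComplete a (r + 1)).sum (truncatedColex r b)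

lemma degree_eq_ncard [Fintype V] (G : SimpleGraph V) (v : V) :
    G.degree v = (G.neighborSet v).ncard := by
  rw [← SimpleGraph.card_neighborSet_eq_degree, Set.ncard_eq_toFinset_card', Set.toFinset_card]

lemma hasEdgesMaxDegree_extremalGraph {a r b : ℕ} (hb : b ≤ (r + 1).choose 2) :
    HasEdgesMaxDegree (extremalGraph a r b) (a * (r + 1).choose 2 + b) r := by
  constructor
  · rw [← card_edgeFinset_copiesComplete a r, SimpleGraph.edgeFinset_card]
    conv_rhs => rw [← card_edgeFinset_truncatedColex hb]
    rw [SimpleGraph.edgeFinset_card, SimpleGraph.edgeFinset_card, ← Fintype.card_sum]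
    exact Fintype.card_congr SimpleGraph.edgeSetSumEquiv
  · refine SimpleGraph.maxDegree_le_of_forall_degree_le _ r fun v => ?_
    rcases v with p | x
    · refine le_of_eq ?_
      rw [degree_eq_ncard, extremalGraph, SimpleGraph.neighborSet_sum_inl,
        Set.ncard_image_of_injective _ Sum.inl_injective, ← degree_eq_ncard,
        degree_copiesComplete]
    · rw [degree_eq_ncard, extremalGraph, SimpleGraph.neighborSet_sum_inr,
        Set.ncard_image_of_injective _ Sum.inr_injective, ← degree_eq_ncard]
      have hlt := (truncatedColex r b).degree_lt_card_verts x
      rw [Fintype.card_fin] at hlt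
      exact Nat.lt_succ_iff.1 hlt

/-- Finiteness is needed because `gBound` counts cliques of an infinite graph with `Set.ncard`. -/
lemma finite_cliques_sum_colexGraph [Fintype V] (G : SimpleGraph V) (b : ℕ) :
    {K : Finset (V ⊕ ℕ) | (G.sum (colexGraph b)).IsClique (K : Set (V ⊕ ℕ)) ∧
      2 ≤ #K}.Finite := by
  refine (Finset.finite_toSet (Finset.univ.disjSum (Finset.range (b + 1))).powerset).subset ?_
  rintro K ⟨hK, h2⟩
  rw [Finset.mem_coe, Finset.mem_powerset]
  intro u hu
  rcases u with u | u
  · simp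
  · rw [Finset.inr_mem_disjSum, Finset.mem_range]
    obtain ⟨w, hw, hne⟩ := Finset.exists_mem_ne (by omega : 1 < #K) (Sum.inr u)
    have hadj := hK hu hw hne.symm
    rcases w with w | w
    · simp at hadj
    · have h3 := (SimpleGraph.sum_adj_inr.1 hadj).2
      have hM : ∀ M : ℕ, M ≤ M.choose 2 + 1 := by
        intro M
        rcases M with _ | M
        · simp
        · rw [choose_two_succ]; omega
      have := hM (max u w)
      omega

lemma numCliques_extremalGraph_le_gBound (m r : ℕ) :
    numCliques (extremalGraph (m / (r + 1).choose 2) r (m % (r + 1).choose 2)) ≤ gBound m r :=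
  numCliques_le_of_embedding
    (SimpleGraph.Embedding.sum SimpleGraph.Embedding.refl
      (SimpleGraph.Embedding.comap Fin.valEmbedding _))
    (finite_cliques_sum_colexGraph _ _)

lemma two_pow_le_numCliques_truncatedColex {k r b : ℕ} (hk : k ≤ r + 1) (hb : k.choose 2 ≤ b) :
    (2 : ℝ) ^ k - k - 1 ≤ numCliques (truncatedColex r b) := by
  have hcl : (truncatedColex r b).IsClique
      ((Finset.univ.map (Fin.castLEEmb hk) : Finset (Fin (r + 1))) : Set (Fin (r + 1))) := by
    intro x hx y hy hxy
    simp only [Finset.coe_map, Set.mem_image] at hx hy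
    obtain ⟨x, -, rfl⟩ := hx
    obtain ⟨y, -, rfl⟩ := hy
    have hne : (x : ℕ) ≠ y := fun h => hxy (by rw [Fin.ext h])
    refine ⟨hne, lt_of_lt_of_le ?_ hb⟩
    have hM : max (x : ℕ) y + 1 ≤ k := by have := x.2; have := y.2; omega
    have h1 := Nat.choose_le_choose 2 hM
    rw [choose_two_succ] at h1
    change (max (x : ℕ) y).choose 2 + min (x : ℕ) y < k.choose 2
    omega
  have h := two_pow_card_le_numCliques hcl
  rw [Finset.card_map, Finset.card_univ, Fintype.card_fin] at h
  have : (2 : ℝ) ^ k ≤ numCliques (truncatedColex r b) + k + 1 := by exact_mod_cast h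
  linarith

end ExtremalGraph

/-! ### Comparison of the two bounds -/

section Comparison

/-- The numerical comparison between the linear bound and the extremal graph. The hypotheses on
`X` are the only properties of the number of cliques of `𝒞(b)` that are needed. -/
lemma linear_bound_lt {a b r : ℕ} {X : ℝ} (hr : 2 ≤ r) (ha : 1 ≤ a) (hb : b < (r + 1).choose 2)
    (hbX : (b : ℝ) ≤ X)
    (hX : ∀ k ≤ r + 1, k.choose 2 ≤ b → (2 : ℝ) ^ k - k - 1 ≤ X) :
    2 * (a * (r + 1).choose 2 + b : ℝ) * completeDensity (r - 1) <
      a * completeCliques r + X := by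
  obtain ⟨k, rfl⟩ : ∃ k, r = k + 2 := ⟨r - 2, by omega⟩
  rw [show k + 2 - 1 = k + 1 by omega]
  have hk : (0 : ℝ) ≤ k := by positivity
  have hF := completeCliques_nonneg (k + 1)
  have hrec := completeCliques_succ (k + 1)
  rw [show k + 1 + 1 = k + 2 by omega] at hrec
  have cN : ((k + 2 + 1).choose 2 : ℝ) = (k + 2) * (k + 3) / 2 := by
    rw [Nat.cast_choose_two]; push_cast; ring
  have cM : ((k + 2).choose 2 : ℝ) = (k + 1) * (k + 2) / 2 := by
    rw [Nat.cast_choose_two]; push_cast; ring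
  have cL : ((k + 1).choose 2 : ℝ) = k * (k + 1) / 2 := by
    rw [Nat.cast_choose_two]; push_cast; ring
  have hX0 : 0 ≤ X := (Nat.cast_nonneg b).trans hbX
  -- It suffices to treat one copy of `K_{r+1}`: the others are at least as dense as the bound.
  have one : 2 * ((k + 2 + 1).choose 2 + b : ℝ) * completeDensity (k + 1) <
      completeCliques (k + 2) + X := by
    unfold completeDensity
    rw [← mul_div_assoc, div_lt_iff₀ (by push_cast; positivity), cN, hrec]
    push_cast
    -- The excess of the edges over two copies of `K_r` must be paid for by `𝒞(b)`.
    suffices h : (2 * b - k * (k + 1) + 2) * completeCliques (k + 1) <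
        (k + 1) * (k + 2) * (k + 2 + X) by nlinarith
    by_cases h1 : b < (k + 1).choose 2
    · have h1' : (b : ℝ) + 1 ≤ (k + 1).choose 2 := by exact_mod_cast h1
      rw [cL] at h1'
      have : (2 * b - k * (k + 1) + 2 : ℝ) * completeCliques (k + 1) ≤ 0 :=
        mul_nonpos_of_nonpos_of_nonneg (by linarith) hF
      have : (0 : ℝ) < (k + 1) * (k + 2) * (k + 2 + X) := by positivity
      linarith
    push Not at h1
    -- For `r = k + 2 ≤ 4` the bound `b ≤ X` is enough.
    rcases Nat.lt_or_ge k 3 with h3 | h3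
    · have hb' : (b : ℝ) + 1 ≤ (k + 2 + 1).choose 2 := by exact_mod_cast hb
      rw [cN] at hb'
      interval_cases k <;> norm_num [completeCliques] at hb' ⊢ <;> linarith
    · have hk3 : (3 : ℝ) ≤ k := by exact_mod_cast h3
      by_cases h2 : b < (k + 2).choose 2
      · have h2' : (b : ℝ) + 1 ≤ (k + 2).choose 2 := by exact_mod_cast h2
        rw [cM] at h2'
        have hlt : completeCliques (k + 1) < 2 * (2 ^ (k + 1)) := by
          simp only [completeCliques]; push_cast; rw [pow_succ]; linarith
        have hX1 := hX (k + 1) (by omega) h1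
        push_cast at hX1
        have hP : (0 : ℝ) < 2 ^ (k + 1) := by positivity
        calc (2 * b - k * (k + 1) + 2) * completeCliques (k + 1)
            ≤ (2 * (k + 1)) * completeCliques (k + 1) :=
              mul_le_mul_of_nonneg_right (by linarith) hF
          _ < (2 * (k + 1)) * (2 * 2 ^ (k + 1)) := mul_lt_mul_of_pos_left hlt (by positivity)
          _ = (k + 1) * 4 * 2 ^ (k + 1) := by ring
          _ ≤ (k + 1) * (k + 2) * (k + 2 + X) := by
            refine mul_le_mul ?_ (by linarith) hP.le (by positivity)
            exact mul_le_mul_of_nonneg_left (by linarith) (by positivity)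
      · push Not at h2
        have hX2 := hX (k + 2) (by omega) h2
        have hbN : (b : ℝ) + 1 ≤ (k + 2 + 1).choose 2 := by exact_mod_cast hb
        rw [cN] at hbN
        have hX2' : completeCliques (k + 1) ≤ X := by
          refine le_trans (le_of_eq ?_) hX2
          simp only [completeCliques]; push_cast; ring
        calc (2 * b - k * (k + 1) + 2) * completeCliques (k + 1)
            ≤ ((k + 1) * (k + 2)) * completeCliques (k + 1) :=
              mul_le_mul_of_nonneg_right (by nlinarith) hF
          _ < (k + 1) * (k + 2) * (k + 2 + X) :=
              mul_lt_mul_of_pos_left (by linarith) (by positivity)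
  have dense : 2 * ((k + 2 + 1).choose 2 : ℝ) * completeDensity (k + 1) ≤
      completeCliques (k + 2) := by
    have h := completeCliques_mul_le (k + 1)
    rw [show k + 1 + 1 = k + 2 by omega] at h
    push_cast at h
    unfold completeDensity
    rw [← mul_div_assoc, div_le_iff₀ (by push_cast; positivity), cN]
    push_cast
    nlinarith [mul_le_mul_of_nonneg_left h (by positivity : (0 : ℝ) ≤ k + 2)]
  have ha' : (1 : ℝ) ≤ a := by exact_mod_cast ha
  have := mul_le_mul_of_nonneg_left dense (sub_nonneg.2 ha')
  linarith

end Comparison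

namespace SimpleGraph

section Main

open scoped Classical

variable {V : Type*} [Fintype V]

/-- Every cluster allowed by the hypothesis occupies at most half of a closed neighbourhood. -/
lemma IsCluster.two_mul_card_le {G : SimpleGraph V} {r : ℕ} {T : Finset V}
    (hT : G.IsCluster r T) (hdeg : ∀ v, G.degree v ≤ r) (hconn : G.Connected) (htop : G ≠ ⊤)
    (h : G.IsUnfoldable T ∨ 2 * #T ≤ r) : 2 * #T ≤ r := by
  rcases h with h | h
  · obtain ⟨y, hy⟩ := hT.prop.commonNbrs_nonempty hdeg hconn htop
    have h1 := h.two_pow_card_le hT.prop hdeg ⟨y, hy, hT.exists_not_adj hy⟩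
    have h2 := hT.prop.2.2
    rw [Set.ncard_eq_toFinset_card'] at h2
    have h3 := Nat.lt_two_pow_self (n := #T)
    omega
  · exact h

lemma cliqueWeight_le (G : SimpleGraph V) {r : ℕ} (hdeg : ∀ v, G.degree v ≤ r)
    (hconn : G.Connected) (htop : G ≠ ⊤)
    (h : ∀ T : Finset V, G.IsCluster r T → 2 * #T ≤ r) (v : V) :
    G.cliqueWeight v ≤ G.degree v * completeDensity (r - 1) := by
  rcases (hdeg v).lt_or_eq with hv | hv
  · refine (G.cliqueWeight_le_of_degree v).trans ?_
    exact mul_le_mul_of_nonneg_left (completeDensity_mono (by omega)) (Nat.cast_nonneg _)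
  · obtain ⟨T, hT, hvT⟩ := G.exists_isCluster_mem (v := v)
    rw [hv] at hT ⊢
    have h2 := hT.prop.2.2
    rw [Set.ncard_eq_toFinset_card'] at h2
    have hc := Finset.card_erase_add_one hvT
    refine G.cliqueWeight_le_of_cluster (hT.prop.neighborFinset_eq hdeg hvT) (by omega) ?_
      (hT.prop.commonNbrs_nonempty hdeg hconn htop) fun y hy => hT.exists_not_adj hy
    rw [hc]
    exact h T hT

end Main

end SimpleGraph

theorem mainTheorem3 {V : Type*} [Fintype V] (G : SimpleGraph V) (m r : ℕ)
    (hconn : G.Connected) (hG : HasEdgesMaxDegree G m r)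
    (hm : (r + 1).choose 2 ≤ m) (hcomplete : G ≠ ⊤)
    (hcluster : ∀ T : Finset V, G.IsCluster r T →
      G.IsUnfoldable T ∨ (r ≤ (G.redGraph T).edgeSet.ncard + 2 ∧ 2 * T.card ≤ r)) :
    ¬ IsExtremal G m r ∧ numCliques G < gBound m r := by
  classical
  obtain ⟨hm', hdeg'⟩ := hG
  have hdeg : ∀ v, G.degree v ≤ r := by
    intro v
    convert (G.degree_le_maxDegree v).trans (le_of_eq_of_le (by congr!) hdeg')
  have hhalf : ∀ T : Finset V, G.IsCluster r T → 2 * #T ≤ r := fun T hT =>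
    hT.two_mul_card_le hdeg hconn hcomplete ((hcluster T hT).imp_right And.right)
  have hr : 2 ≤ r := by
    have : Nontrivial V := by
      by_contra hV
      rw [not_nontrivial_iff_subsingleton] at hV
      exact hcomplete (Subsingleton.elim _ _)
    obtain ⟨v⟩ := hconn.nonempty
    have hpos := hconn.preconnected.degree_pos_of_nontrivial v
    by_contra hlt
    obtain ⟨T, hT, hvT⟩ := G.exists_isCluster_mem (v := v)
    have hv : G.degree v = r := by have := hdeg v; omega
    rw [hv] at hT
    have := hhalf T hT
    have := Finset.card_pos.2 ⟨v, hvT⟩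
    omega
  have hupper : (numCliques G : ℝ) ≤ 2 * m * completeDensity (r - 1) := by
    have hsum : ∑ v, (G.degree v : ℝ) = 2 * m := by
      have := G.sum_degrees_eq_twice_card_edges
      rw [show #G.edgeFinset = m by convert hm'] at this
      exact_mod_cast this
    rw [G.numCliques_eq_sum_cliqueWeight, ← hsum, Finset.sum_mul]
    refine Finset.sum_le_sum fun v _ => ?_
    convert G.cliqueWeight_le hdeg hconn hcomplete hhalf v
  set N := (r + 1).choose 2 with hN
  have hNpos : 0 < N := Nat.choose_pos (by omega)
  have hmod : m % N < N := Nat.mod_lt _ hNpos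
  have hdiv : 1 ≤ m / N := (Nat.one_le_div_iff hNpos).2 hm
  have hmab : m / N * N + m % N = m := Nat.div_add_mod' m N
  have hlower : (m / N : ℕ) * completeCliques r + numCliques (truncatedColex r (m % N)) ≤
      numCliques (extremalGraph (m / N) r (m % N)) := by
    have h1 := le_numCliques_copiesComplete (m / N) r
    have h2 : (numCliques (copiesComplete (m / N) (r + 1)) : ℝ) +
        numCliques (truncatedColex r (m % N)) ≤ numCliques (extremalGraph (m / N) r (m % N)) := by
      exact_mod_cast numCliques_add_le_sum (copiesComplete (m / N) (r + 1))
        (truncatedColex r (m % N))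
    linarith
  have hlt : numCliques G < numCliques (extremalGraph (m / N) r (m % N)) := by
    have h := linear_bound_lt (X := numCliques (truncatedColex r (m % N))) hr hdiv hmod
      (by
        have := card_edgeFinset_le_numCliques (truncatedColex r (m % N))
        rw [card_edgeFinset_truncatedColex hmod.le] at this
        exact_mod_cast this)
      (fun k hk hb => two_pow_le_numCliques_truncatedColex hk hb)
    rw [← hN, show ((m / N : ℕ) * (N : ℝ) + (m % N : ℕ)) = m by exact_mod_cast hmab] at h
    have : (numCliques G : ℝ) < numCliques (extremalGraph (m / N) r (m % N)) := by linarith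
    exact_mod_cast this
  refine ⟨fun hext => ?_, hlt.trans_le (numCliques_extremalGraph_le_gBound m r)⟩
  obtain ⟨h1, h2⟩ := hasEdgesMaxDegree_extremalGraph (a := m / N) (r := r) hmod.le
  rw [← hN, hmab] at h1
  -- Transport the competitor to a vertex set `Fin n`, as in the definition of extremality.
  let f := (extremalGraph (m / N) r (m % N)).overFinIso rfl
  have h3 := hext.2 _ _ ⟨f.card_edgeFinset_eq.symm.trans h1,
    le_of_eq_of_le f.maxDegree_eq.symm h2⟩
  have h4 := numCliques_le_of_embedding f.toEmbedding (Set.toFinite _)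
  omega
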